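/- Let $R$ be a unital associative (not necessarily commutative) ring in which every left ideal and every right ideal is principal. Call $b\in R$ regular if it is neither a left nor a right zero divisor, i.e. if $xb=0$ or $bx=0$ with $x\in R$ forces $x=0$. Elements $a,b\in R$ are right (resp. left) coprime if $Ra+Rb=R$ (resp. $aR+bR=R$). A ring of fractions $Q(R)$ of $R$ is a ring containing $R$ in which every regular element of $R$ is invertible and every element of which has the form $ab^{-1}$ with $a,b\in R$ and $b$ regular. Then such a ring $Q(R)$ exists, and for each such ring and every $f\in Q(R)$: (right) there are $a,b\in R$ with $b$ regular, $f=ab^{-1}$ and $a,b$ right coprime, such that whenever $f=a'b'^{-1}$ with $a',b'\in R$ and $b'$ regular, there is a regular $q\in R$ with $a'=aq$ and $b'=bq$; (left) there are $a,b\in R$ with $b$ regular, $f=b^{-1}a$ and $a,b$ left coprime, such that whenever $f=b'^{-1}a'$ with $a',b'\in R$ and $b'$ regular, there is a regular $q\in R$ with $a'=qa$ and $b'=qb$. -/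

import Mathlib

open scoped nonZeroDivisors

universe u v

/-- `a` and `b` are right coprime: the left ideal `Ra + Rb` is the whole ring. -/
def IsRightCoprime {R : Type*} [Ring R] (a b : R) : Prop :=
  Submodule.span R {a} ⊔ Submodule.span R {b} = (⊤ : Submodule R R)

/-- `a` and `b` are left coprime: the right ideal `aR + bR` is the whole ring.
Right ideals of `R` are the submodules of `R` for the right multiplication action,
that is for the action of the opposite ring. -/
def IsLeftCoprime {R : Type*} [Ring R] (a b : R) : Prop :=
  Submodule.span Rᵐᵒᵖ {a} ⊔ Submodule.span Rᵐᵒᵖ {b} = (⊤ : Submodule Rᵐᵒᵖ R)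

/-- `f = a b⁻¹` in `Q`, where `b` is a regular element of `R` that becomes invertible in `Q`.
Membership in `R⁰` says that `b` is neither a left nor a right zero divisor. -/
def IsRightFraction {R Q : Type*} [Ring R] [Ring Q] (ι : R →+* Q) (f : Q) (a b : R) : Prop :=
  b ∈ R⁰ ∧ ∃ u : Qˣ, (u : Q) = ι b ∧ f = ι a * ((u⁻¹ : Qˣ) : Q)

/-- `f = b⁻¹ a` in `Q`, where `b` is a regular element of `R` that becomes invertible in `Q`. -/
def IsLeftFraction {R Q : Type*} [Ring R] [Ring Q] (ι : R →+* Q) (f : Q) (a b : R) : Prop :=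
  b ∈ R⁰ ∧ ∃ u : Qˣ, (u : Q) = ι b ∧ f = ((u⁻¹ : Qˣ) : Q) * ι a

/-- `Q`, with the embedding `ι : R → Q`, is the ring of fractions of `R`: it contains `R`, every
regular element of `R` is invertible in it, and it consists of the fractions `a b⁻¹` with
`a, b ∈ R` and `b` regular. -/
structure IsRingOfFractions {R Q : Type*} [Ring R] [Ring Q] (ι : R →+* Q) : Prop where
  injective : Function.Injective ι
  isUnit_of_regular : ∀ b ∈ R⁰, IsUnit (ι b)
  exists_fraction : ∀ f : Q, ∃ a b : R, IsRightFraction ι f a b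

/-!
A ring `R` in which every left and every right ideal is principal is Noetherian on both sides. Let
`N` be its largest nilpotent two-sided ideal.

The ring `R / N` is semiprime and Noetherian on both sides, so it has no nonzero singular ideal
(`Ideal.IsEssential.eq_zero_of_mul_eq_zero`). As the multiples of an element with zero annihilator
form an essential ideal, an element of `R / N` regular on one side is regular, and every essential
left ideal, being principal, is generated by a regular element
(`IsSemiprimeRing.exists_mem_nonZeroDivisors`).

These facts lift to `R` because the regular elements of `R` are exactly those that are regular
modulo `N`. First, `N = R z = z R` for some `z` (`exists_isRadicalGenerator`). If `c` is regular
modulo `N`, then comparing `R c + R z` with its generator gives `N = N c`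
(`IsRadicalGenerator.exists_mul_mul_eq`), whence `c` acts injectively on the Noetherian module `N`
and is regular in `R`. Conversely, if right multiplication by `b` is injective on `R`, it is
injective modulo each power of `N`, by descending induction on the exponent
(`IsRadicalGenerator.isRegularMod_of_eq_zero`). So one-sided regular elements of `R` are regular,
and the left Ore condition holds in `R` since it holds modulo `N` and `N = N c` absorbs the error
(`exists_mul_eq_mul`). Everything passes to the other side through the opposite ring.

The Ore localization at the regular elements is then a ring of fractions. The reduced form of a
fraction is obtained by cancelling a generator of the left ideal spanned by its numerator and its
denominator (`IsRingOfFractions.exists_isRightCoprime`).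
-/

/-! ### Essential left ideals -/

/-- The range of an injective endomorphism of a Noetherian module is an essential submodule:
otherwise the sum of `M` and a nonzero cyclic module would embed into `M`. -/
theorem LinearMap.exists_smul_mem_range_of_injective {R M : Type*} [Ring R] [AddCommGroup M]
    [Module R M] [IsNoetherian R M] (f : M →ₗ[R] M) (hf : Function.Injective f) {m : M}
    (hm : m ≠ 0) : ∃ r : R, r • m ≠ 0 ∧ r • m ∈ LinearMap.range f := by
  by_contra! h
  have hinj : Function.Injective (f.coprod (Submodule.span R {m}).subtype) := by
    rw [← LinearMap.ker_eq_bot, LinearMap.ker_eq_bot']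
    rintro ⟨x, y, hy⟩ hxy
    obtain ⟨r, rfl⟩ := Submodule.mem_span_singleton.1 hy
    have hxy' : f x + r • m = 0 := by simpa using hxy
    have hr : r • m = f (-x) := by rw [map_neg]; exact (neg_eq_of_add_eq_zero_right hxy').symm
    have h0 : r • m = 0 := by
      by_contra h0
      exact h r h0 ⟨-x, hr.symm⟩
    have hx : x = 0 := hf (by rw [map_zero]; simpa [h0] using hxy')
    simp [hx, h0]
  have := IsNoetherian.subsingleton_of_prod_injective _ hinj
  exact hm (congrArg Subtype.val (Subsingleton.elim
    (⟨m, Submodule.mem_span_singleton_self m⟩ : Submodule.span R {m}) 0))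

/-- A left ideal `I` is essential if it meets every nonzero left ideal in a nonzero element;
it suffices to ask this for the cyclic left ideals. -/
def Ideal.IsEssential {R : Type*} [Ring R] (I : Ideal R) : Prop :=
  ∀ y : R, y ≠ 0 → ∃ r : R, r * y ≠ 0 ∧ r * y ∈ I

/-- A ring is semiprime if `x R x = 0` only for `x = 0`. -/
def IsSemiprimeRing (R : Type*) [Ring R] : Prop :=
  ∀ x : R, (∀ r, x * r * x = 0) → x = 0

theorem IsSemiprimeRing.op {R : Type*} [Ring R] (h : IsSemiprimeRing R) :
    IsSemiprimeRing Rᵐᵒᵖ := fun x hx ↦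
  MulOpposite.unop_injective <| h _ fun r ↦ by
    simpa [mul_assoc] using congrArg MulOpposite.unop (hx (MulOpposite.op r))

theorem Ideal.isEssential_span_singleton {R : Type*} [Ring R] [IsNoetherianRing R] {c : R}
    (hc : ∀ x, x * c = 0 → x = 0) : (Ideal.span {c}).IsEssential := fun y hy ↦ by
  obtain ⟨r, hr, s, hs⟩ := (LinearMap.toSpanSingleton R R c).exists_smul_mem_range_of_injective
    ((injective_iff_map_eq_zero _).2 fun x hx ↦ hc x (by simpa using hx)) hy
  exact ⟨r, hr, Ideal.mem_span_singleton'.2 ⟨s, by simpa using hs⟩⟩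

/-- The left singular ideal of a left Noetherian semiprime ring is zero. If not, take `x ≠ 0` in it
with the largest possible left annihilator. If `x s x ≠ 0`, then `x s x` has the same
left annihilator as `x`, while some `r` has `r x s ≠ 0` and `r x s x = 0`. -/
theorem Ideal.IsEssential.eq_zero_of_mul_eq_zero {R : Type*} [Ring R] [IsNoetherianRing R]
    (hR : IsSemiprimeRing R) {I : Ideal R} (hI : I.IsEssential) {x : R}
    (hx : ∀ i ∈ I, i * x = 0) : x = 0 := by
  by_contra hx0
  let ann (x : R) : Ideal R := LinearMap.ker (LinearMap.toSpanSingleton R R x)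
  have mem_ann (x r : R) : r ∈ ann x ↔ r * x = 0 := by simp [ann]
  obtain ⟨J, ⟨x, hx0, hess, rfl⟩, hmax⟩ := set_has_maximal_iff_noetherian.2 ‹IsNoetherianRing R›
    {J | ∃ x : R, x ≠ 0 ∧ (ann x).IsEssential ∧ ann x = J}
    ⟨_, x, hx0, fun y hy ↦ (hI y hy).imp fun r hr ↦ ⟨hr.1, (mem_ann _ _).2 (hx _ hr.2)⟩, rfl⟩
  refine hx0 (hR x fun s ↦ ?_)
  by_contra hs
  have hle : ann x ≤ ann (x * s * x) := fun r hr ↦ by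
    rw [mem_ann] at hr ⊢
    rw [← mul_assoc, ← mul_assoc, hr, zero_mul, zero_mul]
  obtain ⟨r, hr, hr'⟩ := hess (x * s) (left_ne_zero_of_mul hs)
  have heq : ann x = ann (x * s * x) := hle.eq_of_not_lt <| hmax _
    ⟨_, hs, fun y hy ↦ (hess y hy).imp fun r hr ↦ ⟨hr.1, hle hr.2⟩, rfl⟩
  have : r ∈ ann x := by
    rw [heq, mem_ann, ← mul_assoc]
    exact (mem_ann _ _).1 hr'
  rw [mem_ann] at this
  exact hr (by rw [← mul_assoc, this, zero_mul])

/-- If the left annihilator of `c` is zero, so is its right annihilator: an `x` with `c x = 0` is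
killed by the essential left ideal `R c`. -/
theorem IsSemiprimeRing.eq_zero_of_mul_eq_zero {R : Type*} [Ring R] [IsNoetherianRing R]
    (hR : IsSemiprimeRing R) {c : R} (hc : ∀ x, x * c = 0 → x = 0) {x : R} (hx : c * x = 0) :
    x = 0 := by
  refine (Ideal.isEssential_span_singleton hc).eq_zero_of_mul_eq_zero hR fun i hi ↦ ?_
  obtain ⟨a, rfl⟩ := Ideal.mem_span_singleton'.1 hi
  rw [mul_assoc, hx, mul_zero]

theorem IsSemiprimeRing.eq_zero_of_mul_eq_zero' {R : Type*} [Ring R] [IsNoetherianRing Rᵐᵒᵖ]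
    (hR : IsSemiprimeRing R) {c : R} (hc : ∀ x, c * x = 0 → x = 0) {x : R} (hx : x * c = 0) :
    x = 0 :=
  MulOpposite.op_injective <| hR.op.eq_zero_of_mul_eq_zero (c := MulOpposite.op c)
    (fun _ hy ↦ MulOpposite.unop_injective (hc _ (congrArg MulOpposite.unop hy)))
    (congrArg MulOpposite.op hx)

/-- In a semiprime principal ideal ring each essential left ideal contains a regular element,
namely any generator `d` of it: first `d x = 0` forces `x = 0`, and then so does `x d = 0`. -/
theorem IsSemiprimeRing.exists_mem_nonZeroDivisors {R : Type*} [Ring R] [IsPrincipalIdealRing R]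
    [IsNoetherianRing Rᵐᵒᵖ] (hR : IsSemiprimeRing R) {I : Ideal R} (hI : I.IsEssential) :
    ∃ d ∈ I, d ∈ R⁰ := by
  obtain ⟨d, rfl⟩ := IsPrincipalIdealRing.principal I
  have hd : ∀ x, d * x = 0 → x = 0 := fun x hx ↦ hI.eq_zero_of_mul_eq_zero hR fun i hi ↦ by
    obtain ⟨a, rfl⟩ := Ideal.mem_span_singleton'.1 hi
    rw [mul_assoc, hx, mul_zero]
  exact ⟨d, Ideal.mem_span_singleton_self d, mem_nonZeroDivisors_iff.2
    ⟨hd, fun x hx ↦ hR.eq_zero_of_mul_eq_zero' hd hx⟩⟩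

theorem op_mem_nonZeroDivisors_iff {R : Type*} [Ring R] {b : R} :
    MulOpposite.op b ∈ Rᵐᵒᵖ⁰ ↔ b ∈ R⁰ := by
  simp only [mem_nonZeroDivisors_iff, MulOpposite.op_surjective.forall, ← MulOpposite.op_mul,
    MulOpposite.op_eq_zero_iff]
  exact and_comm

/-! ### A generator of the nilpotent radical -/

/-- `z` generates the nilpotent radical `N` of `R`, both as a left and as a right ideal: `R z = z R`
is nilpotent, and `R / R z` is semiprime. -/
structure IsRadicalGenerator {R : Type*} [Ring R] (z : R) : Prop where
  left : ∀ r, ∃ s, z * r = s * z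
  right : ∀ r, ∃ s, r * z = z * s
  nilpotent : IsNilpotent z
  semiprime : ∀ x, (∀ r, x * r * x ∈ Ideal.span {z}) → x ∈ Ideal.span {z}

/-- A maximal nilpotent two-sided ideal `N` of a left Noetherian ring has semiprime quotient: if
`x R x ⊆ N`, then `(N + R x R) ^ 2 ⊆ N`, so `N + R x R` is nilpotent. -/
theorem exists_isTwoSided_isNilpotent_semiprime (R : Type*) [Ring R] [IsNoetherianRing R] :
    ∃ N : Ideal R, N.IsTwoSided ∧ IsNilpotent N ∧ ∀ x, (∀ r, x * r * x ∈ N) → x ∈ N := by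
  obtain ⟨N, ⟨hN, k, hk⟩, hmax⟩ : ∃ N : Ideal R, (N.IsTwoSided ∧ IsNilpotent N) ∧
      ∀ J : Ideal R, J.IsTwoSided ∧ IsNilpotent J → ¬N < J :=
    set_has_maximal_iff_noetherian.2 ‹IsNoetherianRing R›
      {N : Ideal R | N.IsTwoSided ∧ IsNilpotent N} ⟨⊥, inferInstance, 1, by simp⟩
  refine ⟨N, hN, ⟨k, hk⟩, fun x hx ↦ ?_⟩
  -- the two-sided ideal `R x R`
  let I : Ideal R := Ideal.span {x} * ⊤
  have hII : I * I ≤ N := by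
    have hxx : Ideal.span {x} * Ideal.span {x} ≤ N := Ideal.mul_le.2 fun a ha b hb ↦ by
      obtain ⟨r, rfl⟩ := Ideal.mem_span_singleton'.1 ha
      obtain ⟨s, rfl⟩ := Ideal.mem_span_singleton'.1 hb
      rw [mul_assoc, ← mul_assoc x]
      exact N.mul_mem_left r (hx s)
    have htop : (⊤ : Ideal R) * Ideal.span {x} = Ideal.span {x} := Ideal.top_mul _
    calc I * I = Ideal.span {x} * (⊤ * Ideal.span {x}) * ⊤ := by simp only [I, mul_assoc]
      _ ≤ N * ⊤ := by rw [htop]; exact Ideal.mul_mono_left hxx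
      _ ≤ N := Ideal.mul_le_left
  have hJJ : (N ⊔ I) * (N ⊔ I) ≤ N := by
    rw [Ideal.sup_mul, Ideal.mul_sup, Ideal.mul_sup]
    exact sup_le (sup_le Ideal.mul_le_right Ideal.mul_le_left) (sup_le Ideal.mul_le_right hII)
  have hJ' : (N ⊔ I).IsTwoSided := ⟨fun {a} b ha ↦ by
    obtain ⟨x, hx, y, hy, rfl⟩ := Submodule.mem_sup.1 ha
    rw [add_mul]
    exact add_mem (Ideal.mem_sup_left (N.mul_mem_right b hx))
      (Ideal.mem_sup_right (I.mul_mem_right b hy))⟩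
  have hJ : IsNilpotent (N ⊔ I) := by
    have hpow (j : ℕ) : (N ⊔ I) ^ (2 * j) ≤ N ^ j := by
      induction j with
      | zero => exact le_rfl
      | succ j ih =>
        rw [mul_add_one, Submodule.pow_succ, Submodule.pow_succ, Submodule.pow_succ, mul_assoc]
        exact Ideal.mul_mono ih hJJ
    exact ⟨2 * k, le_bot_iff.1 ((hpow k).trans hk.le)⟩
  have hN' : N = N ⊔ I := le_sup_left.eq_of_not_lt (hmax _ ⟨hJ', hJ⟩)
  have hxI : x ∈ I := by
    simpa using Ideal.mul_mem_mul (Ideal.mem_span_singleton_self x) (Submodule.mem_top (x := 1))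
  rw [hN']
  exact Ideal.mem_sup_right hxI

/-- The radical `N` of a principal ideal ring has a two-sided generator. Write `N = R w = v R`, with
`w = v t`. Then `N = R w = (R v) t ⊆ N t ⊆ N`, so right multiplication by `t` is a surjective
endomorphism of the Noetherian left module `N`. It is therefore injective, and `(R v) t = N t`
gives `R v = N`. -/
theorem exists_isRadicalGenerator (R : Type*) [Ring R] [IsPrincipalIdealRing R]
    [IsPrincipalIdealRing Rᵐᵒᵖ] : ∃ z : R, IsRadicalGenerator z := by
  obtain ⟨N, hN, ⟨k, hk⟩, hsemi⟩ := exists_isTwoSided_isNilpotent_semiprime R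
  -- `N` as a right ideal
  let N' : Ideal Rᵐᵒᵖ :=
    { carrier := {x | x.unop ∈ N}
      add_mem' := fun ha hb ↦ N.add_mem ha hb
      zero_mem' := N.zero_mem
      smul_mem' := fun c _ hx ↦ N.mul_mem_right c.unop hx }
  obtain ⟨w, hw⟩ := IsPrincipalIdealRing.principal N
  obtain ⟨v', hv'⟩ := IsPrincipalIdealRing.principal N'
  obtain ⟨v, rfl⟩ := MulOpposite.op_surjective v'
  have mem_w (x : R) : x ∈ N ↔ ∃ r, r * w = x := by
    rw [hw]
    exact Ideal.mem_span_singleton'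
  have mem_v (x : R) : x ∈ N ↔ ∃ r, v * r = x := by
    change MulOpposite.op x ∈ N' ↔ _
    rw [hv']
    refine Ideal.mem_span_singleton'.trans ⟨fun ⟨a, ha⟩ ↦ ⟨a.unop, ?_⟩, fun ⟨r, hr⟩ ↦
      ⟨MulOpposite.op r, congrArg MulOpposite.op hr⟩⟩
    exact congrArg MulOpposite.unop ha
  have hvN : v ∈ N := (mem_v v).2 ⟨1, mul_one v⟩
  obtain ⟨t, ht⟩ := (mem_v w).1 ((mem_w w).2 ⟨1, one_mul w⟩)
  let f : N →ₗ[R] N := (LinearMap.toSpanSingleton R R t).restrict fun x hx ↦ by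
    simpa using N.mul_mem_right t hx
  have hf (x : N) : (f x : R) = x * t := rfl
  have hsurj : Function.Surjective f := fun ⟨x, hx⟩ ↦ by
    obtain ⟨r, hr⟩ := (mem_w x).1 hx
    exact ⟨⟨r * v, N.mul_mem_left r hvN⟩, Subtype.ext <| by rw [hf, mul_assoc, ht, hr]⟩
  have hinj := IsNoetherian.injective_of_surjective_endomorphism f hsurj
  have hspan : N = Ideal.span {v} := by
    ext x
    rw [Ideal.mem_span_singleton']
    refine ⟨fun hx ↦ ?_, fun ⟨r, hr⟩ ↦ hr ▸ N.mul_mem_left r hvN⟩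
    obtain ⟨r, hr⟩ := (mem_w _).1 (N.mul_mem_right t hx)
    refine ⟨r, congrArg Subtype.val
      (hinj (a₁ := ⟨r * v, N.mul_mem_left r hvN⟩) (a₂ := ⟨x, hx⟩) (Subtype.ext ?_))⟩
    rw [hf, hf, mul_assoc, ht, hr]
  refine ⟨v, fun r ↦ ?_, fun r ↦ ?_, ⟨k, ?_⟩, fun x hx ↦ ?_⟩
  · have := N.mul_mem_right r hvN
    rw [hspan, Ideal.mem_span_singleton'] at this
    exact this.imp fun _ h ↦ h.symm
  · exact ((mem_v _).1 (N.mul_mem_left r hvN)).imp fun _ h ↦ h.symm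
  · have := Ideal.pow_mem_pow hvN k
    rw [hk] at this
    exact this
  · rw [← hspan] at hx ⊢
    exact hsemi x hx

namespace IsRadicalGenerator

variable {R : Type*} [Ring R] {z : R}

theorem mem_span_iff (hz : IsRadicalGenerator z) {x : R} :
    x ∈ Ideal.span {z} ↔ ∃ r, z * r = x := by
  rw [Ideal.mem_span_singleton']
  constructor
  · rintro ⟨r, rfl⟩
    exact (hz.right r).imp fun _ h ↦ h.symm
  · rintro ⟨r, rfl⟩
    exact (hz.left r).imp fun _ h ↦ h.symm

theorem op_mem_span_iff (hz : IsRadicalGenerator z) {x : R} :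
    MulOpposite.op x ∈ Ideal.span {MulOpposite.op z} ↔ x ∈ Ideal.span {z} := by
  rw [hz.mem_span_iff, Ideal.mem_span_singleton']
  exact ⟨fun ⟨r, hr⟩ ↦ ⟨r.unop, congrArg MulOpposite.unop hr⟩,
    fun ⟨r, hr⟩ ↦ ⟨MulOpposite.op r, congrArg MulOpposite.op hr⟩⟩

theorem op (hz : IsRadicalGenerator z) : IsRadicalGenerator (MulOpposite.op z) where
  left r := (hz.right r.unop).elim fun s hs ↦ ⟨.op s, congrArg MulOpposite.op hs⟩
  right r := (hz.left r.unop).elim fun s hs ↦ ⟨.op s, congrArg MulOpposite.op hs⟩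
  nilpotent := hz.nilpotent.elim fun k hk ↦ ⟨k, congrArg MulOpposite.op hk⟩
  semiprime x hx := hz.op_mem_span_iff.2 <| hz.semiprime x.unop fun r ↦ hz.op_mem_span_iff.1 <| by
    simpa [mul_assoc] using hx (.op r)

theorem exists_pow_mul_eq (hz : IsRadicalGenerator z) (i : ℕ) (r : R) :
    ∃ s, z ^ i * r = s * z ^ i := by
  induction i generalizing r with
  | zero => exact ⟨r, by simp⟩
  | succ i ih =>
    obtain ⟨s, hs⟩ := hz.left r
    obtain ⟨t, ht⟩ := ih s
    exact ⟨t, by rw [pow_succ, mul_assoc, hs, ← mul_assoc, ht, mul_assoc]⟩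

theorem exists_mul_pow_eq (hz : IsRadicalGenerator z) (i : ℕ) (r : R) :
    ∃ s, r * z ^ i = z ^ i * s := by
  induction i generalizing r with
  | zero => exact ⟨r, by simp⟩
  | succ i ih =>
    obtain ⟨s, hs⟩ := ih r
    obtain ⟨t, ht⟩ := hz.right s
    exact ⟨t, by rw [pow_succ, ← mul_assoc, hs, mul_assoc, ht, mul_assoc]⟩

theorem isTwoSided_span_pow (hz : IsRadicalGenerator z) (i : ℕ) :
    (Ideal.span {z ^ i}).IsTwoSided := ⟨fun {a} b ha ↦ by
  obtain ⟨r, rfl⟩ := Ideal.mem_span_singleton'.1 ha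
  obtain ⟨s, hs⟩ := hz.exists_pow_mul_eq i b
  exact Ideal.mem_span_singleton'.2 ⟨r * s, by rw [mul_assoc, mul_assoc, hs]⟩⟩

theorem isTwoSided_span (hz : IsRadicalGenerator z) : (Ideal.span {z}).IsTwoSided := by
  simpa using hz.isTwoSided_span_pow 1

end IsRadicalGenerator

/-! ### Regular elements modulo the radical -/

/-- `c` is regular modulo the left ideal `R z`, which is two-sided when `z` generates the radical. It
is stated in `R`, not in the quotient ring, so that it passes to the opposite ring. -/
def IsRegularMod {R : Type*} [Ring R] (z c : R) : Prop :=
  ∀ x, (x * c ∈ Ideal.span {z} → x ∈ Ideal.span {z}) ∧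
    (c * x ∈ Ideal.span {z} → x ∈ Ideal.span {z})

theorem isPrincipalIdealRing_op_of_surjective {R S : Type*} [Ring R] [Ring S]
    [IsPrincipalIdealRing Rᵐᵒᵖ] (f : R →+* S) (hf : Function.Surjective f) :
    IsPrincipalIdealRing Sᵐᵒᵖ :=
  .of_surjective (RingHom.op f) fun y ↦
    (hf y.unop).elim fun x hx ↦ ⟨.op x, congrArg MulOpposite.op hx⟩

instance {R : Type*} [Ring R] [IsPrincipalIdealRing R] : IsPrincipalIdealRing Rᵐᵒᵖᵐᵒᵖ :=
  .of_surjective (RingEquiv.opOp R) (RingEquiv.opOp R).surjective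

namespace IsRadicalGenerator

variable {R : Type*} [Ring R] {z : R}

theorem isRegularMod_op (hz : IsRadicalGenerator z) {c : R} (hc : IsRegularMod z c) :
    IsRegularMod (MulOpposite.op z) (MulOpposite.op c) := fun x ↦
  ⟨fun h ↦ hz.op_mem_span_iff.2 ((hc x.unop).2 (hz.op_mem_span_iff.1 h)),
    fun h ↦ hz.op_mem_span_iff.2 ((hc x.unop).1 (hz.op_mem_span_iff.1 h))⟩

theorem isSemiprimeRing_quotient (hz : IsRadicalGenerator z) [(Ideal.span {z}).IsTwoSided] :
    IsSemiprimeRing (R ⧸ Ideal.span {z}) := fun x hx ↦ by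
  obtain ⟨x, rfl⟩ := Ideal.Quotient.mk_surjective x
  refine Ideal.Quotient.eq_zero_iff_mem.2 (hz.semiprime x fun r ↦ ?_)
  rw [← Ideal.Quotient.eq_zero_iff_mem, map_mul, map_mul]
  exact hx _

theorem isRegularMod_iff [(Ideal.span {z}).IsTwoSided] {c : R} :
    IsRegularMod z c ↔ Ideal.Quotient.mk (Ideal.span {z}) c ∈ (R ⧸ Ideal.span {z})⁰ := by
  rw [mem_nonZeroDivisors_iff, Ideal.Quotient.mk_surjective.forall,
    Ideal.Quotient.mk_surjective.forall]
  simp only [← map_mul, Ideal.Quotient.eq_zero_iff_mem]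
  exact ⟨fun h ↦ ⟨fun x ↦ (h x).2, fun x ↦ (h x).1⟩, fun h x ↦ ⟨h.2 x, h.1 x⟩⟩

theorem isRegularMod_of_mul_mem [IsPrincipalIdealRing R] (hz : IsRadicalGenerator z) {c : R}
    (hc : ∀ x, x * c ∈ Ideal.span {z} → x ∈ Ideal.span {z}) : IsRegularMod z c := by
  have := hz.isTwoSided_span
  have hc' : ∀ x, x * Ideal.Quotient.mk (Ideal.span {z}) c = 0 → x = 0 := by
    rw [Ideal.Quotient.mk_surjective.forall]
    simpa only [← map_mul, Ideal.Quotient.eq_zero_iff_mem] using hc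
  have := IsPrincipalIdealRing.of_surjective _ (Ideal.Quotient.mk_surjective (I := Ideal.span {z}))
  exact isRegularMod_iff.2 <| mem_nonZeroDivisors_iff.2
    ⟨fun x hx ↦ hz.isSemiprimeRing_quotient.eq_zero_of_mul_eq_zero hc' hx, hc'⟩

theorem isRegularMod_of_mul_mem' [IsPrincipalIdealRing Rᵐᵒᵖ] (hz : IsRadicalGenerator z) {c : R}
    (hc : ∀ x, c * x ∈ Ideal.span {z} → x ∈ Ideal.span {z}) : IsRegularMod z c := by
  have hc' := hz.op.isRegularMod_of_mul_mem (c := .op c) fun x hx ↦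
    hz.op_mem_span_iff.2 (hc x.unop (hz.op_mem_span_iff.1 hx))
  exact fun x ↦ ⟨fun h ↦ hz.op_mem_span_iff.1 ((hc' (.op x)).2 (hz.op_mem_span_iff.2 h)), hc x⟩

variable [IsPrincipalIdealRing R] [IsPrincipalIdealRing Rᵐᵒᵖ]

/-- A left ideal that is essential modulo the radical contains an element that is regular modulo
the radical. -/
theorem exists_mem_isRegularMod (hz : IsRadicalGenerator z) {I : Ideal R}
    (hI : ∀ y ∉ Ideal.span {z}, ∃ r, r * y ∉ Ideal.span {z} ∧ r * y ∈ I) :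
    ∃ c ∈ I, IsRegularMod z c := by
  have := hz.isTwoSided_span
  have := IsPrincipalIdealRing.of_surjective _ (Ideal.Quotient.mk_surjective (I := Ideal.span {z}))
  have := isPrincipalIdealRing_op_of_surjective _
    (Ideal.Quotient.mk_surjective (I := Ideal.span {z}))
  have hess : (I.map (Ideal.Quotient.mk (Ideal.span {z}))).IsEssential := by
    intro y hy
    obtain ⟨y, rfl⟩ := Ideal.Quotient.mk_surjective y
    obtain ⟨r, hr, hrI⟩ := hI y (mt Ideal.Quotient.eq_zero_iff_mem.2 hy)
    refine ⟨Ideal.Quotient.mk _ r, ?_, ?_⟩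
    · rwa [← map_mul, Ne, Ideal.Quotient.eq_zero_iff_mem]
    · rw [← map_mul]
      exact Ideal.mem_map_of_mem _ hrI
  obtain ⟨d, hd, hreg⟩ := hz.isSemiprimeRing_quotient.exists_mem_nonZeroDivisors hess
  obtain ⟨c, hc, rfl⟩ := (Ideal.mem_map_iff_of_surjective _ Ideal.Quotient.mk_surjective).1 hd
  exact ⟨c, hc, isRegularMod_iff.2 hreg⟩

/-- If `c` is regular modulo the radical `N = R z`, then `N = N c`. Let `d` generate `R c + R z`,
with `z = t d`. As `d` divides `c`, it is regular modulo `N`, so `t` lies in `N = z R`. Hence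
`z ∈ z R d ⊆ N c + R z ^ 2`, and iterating this, `z ∈ N c` by nilpotency. -/
theorem exists_mul_mul_eq (hz : IsRadicalGenerator z) {c : R} (hc : IsRegularMod z c) :
    ∃ y, y * z * c = z := by
  have := hz.isTwoSided_span
  obtain ⟨d, hd⟩ := IsPrincipalIdealRing.principal (Ideal.span {c, z})
  have mem_d (x : R) : x ∈ Ideal.span {c, z} ↔ ∃ r, r * d = x := by
    rw [hd]
    exact Ideal.mem_span_singleton'
  obtain ⟨w, hw⟩ := (mem_d c).1 (Ideal.subset_span (by simp))
  obtain ⟨t, ht⟩ := (mem_d z).1 (Ideal.subset_span (by simp))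
  obtain ⟨u, v, huv⟩ := Ideal.mem_span_pair.1 ((mem_d d).2 ⟨1, one_mul d⟩)
  have hdreg : IsRegularMod z d := hz.isRegularMod_of_mul_mem' fun x hx ↦ (hc x).2 <| by
    rw [← hw, mul_assoc]
    exact Ideal.mul_mem_left _ w hx
  have htN : t ∈ Ideal.span {z} := (hdreg t).1 (ht ▸ Ideal.mem_span_singleton_self z)
  obtain ⟨t', rfl⟩ := hz.mem_span_iff.1 htN
  obtain ⟨n, hn⟩ := hz.left (t' * u)
  obtain ⟨m, hm⟩ := hz.left (t' * v)
  have hstep : z = n * z * c + m * z ^ 2 := by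
    calc z = z * (t' * u) * c + z * (t' * v) * z := by
          conv_lhs => rw [← ht, ← huv]
          simp only [mul_add, mul_assoc]
      _ = _ := by rw [hn, hm, pow_two, mul_assoc m]
  have key : ∀ j, ∃ y m, z = y * z * c + m * z ^ (j + 1) := by
    intro j
    induction j with
    | zero => exact ⟨0, 1, by simp⟩
    | succ j ih =>
      obtain ⟨y, m', hy⟩ := ih
      obtain ⟨s, hs⟩ := hz.exists_pow_mul_eq j m
      refine ⟨y + m' * z ^ j * n, m' * s, ?_⟩
      calc z = y * z * c + m' * z ^ j * z := by rw [mul_assoc m', ← pow_succ]; exact hy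
        _ = y * z * c + m' * z ^ j * (n * z * c + m * z ^ 2) := by rw [← hstep]
        _ = (y + m' * z ^ j * n) * z * c + m' * (z ^ j * m) * z ^ 2 := by
          simp only [mul_add, add_mul, mul_assoc, add_assoc]
        _ = _ := by rw [hs, ← mul_assoc m', mul_assoc (m' * s), ← pow_add]
  obtain ⟨k, hk⟩ := hz.nilpotent
  obtain ⟨y, m', hy⟩ := key k
  exact ⟨y, by rw [pow_succ, hk, zero_mul, mul_zero, add_zero] at hy; exact hy.symm⟩

/-- An element `c` regular modulo `N` has zero left annihilator: right multiplication by `c` is a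
surjective endomorphism of the Noetherian module `N = N c`, hence injective, and the left annihilator
of `c` lies in `N`. -/
theorem eq_zero_of_mul_eq_zero (hz : IsRadicalGenerator z) {c : R} (hc : IsRegularMod z c) {x : R}
    (hx : x * c = 0) : x = 0 := by
  have := hz.isTwoSided_span
  let f : Ideal.span {z} →ₗ[R] Ideal.span {z} :=
    (LinearMap.toSpanSingleton R R c).restrict fun x hx ↦ by
      simpa using Ideal.mul_mem_right c (Ideal.span {z}) hx
  have hf (x : Ideal.span {z}) : (f x : R) = x * c := rfl
  have hsurj : Function.Surjective f := fun ⟨x, hx⟩ ↦ by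
    obtain ⟨r, rfl⟩ := Ideal.mem_span_singleton'.1 hx
    obtain ⟨y, hy⟩ := hz.exists_mul_mul_eq hc
    exact ⟨⟨r * y * z, Ideal.mul_mem_left _ _ (Ideal.mem_span_singleton_self z)⟩,
      Subtype.ext <| by
        change r * y * z * c = r * z
        rw [mul_assoc r, mul_assoc, hy]⟩
  have hinj := IsNoetherian.injective_of_surjective_endomorphism f hsurj
  have hxN : x ∈ Ideal.span {z} := (hc x).1 (by rw [hx]; exact zero_mem _)
  exact congrArg Subtype.val
    (hinj (a₁ := ⟨x, hxN⟩) (a₂ := 0) (Subtype.ext (by rw [hf, map_zero, hx]; rfl)))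

/-- An element regular modulo the radical is regular. -/
theorem mem_nonZeroDivisors (hz : IsRadicalGenerator z) {c : R} (hc : IsRegularMod z c) :
    c ∈ R⁰ :=
  mem_nonZeroDivisors_iff.2 ⟨fun _ hx ↦ MulOpposite.op_injective <|
    hz.op.eq_zero_of_mul_eq_zero (hz.isRegularMod_op hc) (congrArg MulOpposite.op hx),
    fun _ hx ↦ hz.eq_zero_of_mul_eq_zero hc hx⟩

/-- Elements `c` regular modulo `N` can be cancelled modulo each power of `N`, because `N = c N`. -/
theorem mem_span_pow_of_mul_mem (hz : IsRadicalGenerator z) {c : R} (hc : IsRegularMod z c) {i : ℕ}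
    {x : R} (hx : c * x ∈ Ideal.span {z ^ i}) : x ∈ Ideal.span {z ^ i} := by
  obtain _ | i := i
  · simp
  obtain ⟨y, hy⟩ := hz.op.exists_mul_mul_eq (hz.isRegularMod_op hc)
  have hy : c * (z * y.unop) = z := congrArg MulOpposite.unop hy
  obtain ⟨r, hr⟩ := Ideal.mem_span_singleton'.1 hx
  obtain ⟨s, hs⟩ := hz.exists_mul_pow_eq (i + 1) r
  have hcx : c * (x - z * y.unop * z ^ i * s) = 0 := by
    rw [mul_sub, ← hr, hs, ← mul_assoc, ← mul_assoc, hy, pow_succ', sub_self]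
  have hxz := sub_eq_zero.1 ((mem_nonZeroDivisors_iff.1 (hz.mem_nonZeroDivisors hc)).1 _ hcx)
  have := hz.isTwoSided_span_pow (i + 1)
  obtain ⟨a, ha⟩ := hz.exists_mul_pow_eq i y.unop
  rw [hxz, mul_assoc z, ha, ← mul_assoc, ← pow_succ', mul_assoc]
  exact Ideal.mul_mem_right _ _ (Ideal.mem_span_singleton_self _)

end IsRadicalGenerator

/-! ### Regularity modulo the radical is regularity -/

/-- If right multiplication by `b` is injective on `A / B`, for left ideals `B` and `A`, then its
image is essential in `A / B`. -/
theorem Ideal.exists_mul_sub_mem_of_injective {R : Type*} [Ring R] [IsNoetherianRing R]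
    {A B : Ideal R} {b : R} (hA : ∀ x ∈ A, x * b ∈ A) (hB : ∀ x ∈ B, x * b ∈ B)
    (hinj : ∀ x ∈ A, x * b ∈ B → x ∈ B) {m : R} (hm : m ∈ A) (hmB : m ∉ B) :
    ∃ r, r * m ∉ B ∧ ∃ n ∈ A, r * m - n * b ∈ B := by
  have hB' : B ≤ Submodule.comap (LinearMap.toSpanSingleton R R b) B := fun x hx ↦ by simpa using hB x hx
  let f : Submodule.map B.mkQ A →ₗ[R] Submodule.map B.mkQ A :=
    (Submodule.mapQ B B (LinearMap.toSpanSingleton R R b) hB').restrict <| by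
      rintro _ ⟨x, hx, rfl⟩
      exact ⟨x * b, hA x hx, by simp⟩
  have hf (x : R) (hx : x ∈ A) :
      (f ⟨B.mkQ x, Submodule.mem_map_of_mem hx⟩ : R ⧸ B) = B.mkQ (x * b) := by
    simp [f, LinearMap.restrict_apply]
  have hfinj : Function.Injective f := (injective_iff_map_eq_zero f).2 <| by
    rintro ⟨_, x, hx, rfl⟩ h
    have h' := (hf x hx).symm.trans (congrArg Subtype.val h)
    exact Subtype.ext <| (Submodule.Quotient.mk_eq_zero B).2 <| hinj x hx <|
      (Submodule.Quotient.mk_eq_zero B).1 h'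
  obtain ⟨r, hr, ⟨_, n, hn, rfl⟩, hrn⟩ := f.exists_smul_mem_range_of_injective hfinj
    (m := ⟨B.mkQ m, Submodule.mem_map_of_mem hm⟩)
    fun h ↦ hmB ((Submodule.Quotient.mk_eq_zero B).1 (congrArg Subtype.val h))
  have hrm : ((r • ⟨B.mkQ m, Submodule.mem_map_of_mem hm⟩ : Submodule.map B.mkQ A) : R ⧸ B) =
      B.mkQ (r * m) := rfl
  refine ⟨r, fun h ↦ hr (Subtype.ext ((Submodule.Quotient.mk_eq_zero B).2 h)), n, hn, ?_⟩
  have := (hf n hn).symm.trans (congrArg Subtype.val hrn)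
  rw [hrm] at this
  exact (Submodule.Quotient.eq B).1 this.symm

namespace IsRadicalGenerator

variable {R : Type*} [Ring R] [IsPrincipalIdealRing R] [IsPrincipalIdealRing Rᵐᵒᵖ] {z : R}

/-- If right multiplication by `b` is injective modulo `N ^ (i + 1)`, then it is injective modulo
`N ^ i`. Suppose `x b ∈ N ^ i`. Since `N ^ i b` is essential in `N ^ i` modulo `N ^ (i + 1)`, some
`c` regular modulo `N` has `c x b = n b` modulo `N ^ (i + 1)` with `n ∈ N ^ i`. So `c x ∈ N ^ i`,
and `c` can be cancelled. -/
theorem mem_span_pow_of_succ (hz : IsRadicalGenerator z) {b : R} {i : ℕ}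
    (hb : ∀ x, x * b ∈ Ideal.span {z ^ (i + 1)} → x ∈ Ideal.span {z ^ (i + 1)}) {x : R}
    (hx : x * b ∈ Ideal.span {z ^ i}) : x ∈ Ideal.span {z ^ i} := by
  have := hz.isTwoSided_span_pow i
  have := hz.isTwoSided_span_pow (i + 1)
  have hle : Ideal.span {z ^ (i + 1)} ≤ Ideal.span {z ^ i} :=
    (Ideal.span_singleton_le_iff_mem _).2 <| by
      rw [pow_succ']
      exact Ideal.mul_mem_left _ _ (Ideal.mem_span_singleton_self _)
  -- the left ideal of those `s` with `s x b ∈ N ^ i b + N ^ (i + 1)`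
  let I : Ideal R :=
    { carrier := {s | ∃ n ∈ Ideal.span {z ^ i}, s * (x * b) - n * b ∈ Ideal.span {z ^ (i + 1)}}
      add_mem' := by
        rintro s t ⟨m, hm, hm'⟩ ⟨n, hn, hn'⟩
        refine ⟨m + n, add_mem hm hn, ?_⟩
        convert add_mem hm' hn' using 1
        noncomm_ring
      zero_mem' := ⟨0, zero_mem _, by simp⟩
      smul_mem' := by
        rintro r s ⟨n, hn, hn'⟩
        refine ⟨r * n, Ideal.mul_mem_left _ r hn, ?_⟩
        convert Ideal.mul_mem_left _ r hn' using 1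
        simp only [smul_eq_mul, mul_sub, mul_assoc] }
  have hzx : ∀ y ∈ Ideal.span {z}, y * (x * b) ∈ Ideal.span {z ^ (i + 1)} := fun y hy ↦ by
    obtain ⟨u, rfl⟩ := Ideal.mem_span_singleton'.1 hy
    obtain ⟨w, hw⟩ := Ideal.mem_span_singleton'.1 hx
    obtain ⟨s, hs⟩ := hz.left w
    exact Ideal.mem_span_singleton'.2
      ⟨u * s, by rw [← hw, mul_assoc u z, ← mul_assoc z, hs, pow_succ', mul_assoc, mul_assoc]⟩
  obtain ⟨c, ⟨n, hn, hn'⟩, hc⟩ := hz.exists_mem_isRegularMod (I := I) fun y hy ↦ by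
    by_cases hyx : y * (x * b) ∈ Ideal.span {z ^ (i + 1)}
    · exact ⟨1, by rwa [one_mul], 0, zero_mem _, by rwa [one_mul, zero_mul, sub_zero]⟩
    · obtain ⟨r, hr, n, hn, hn'⟩ := Ideal.exists_mul_sub_mem_of_injective
        (fun x hx ↦ Ideal.mul_mem_right b _ hx) (fun x hx ↦ Ideal.mul_mem_right b _ hx)
        (fun x _ hx ↦ hb x hx) (Ideal.mul_mem_left _ y hx) hyx
      rw [← mul_assoc] at hr hn'
      exact ⟨r, fun h ↦ hr (hzx _ h), n, hn, hn'⟩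
  refine hz.mem_span_pow_of_mul_mem hc ?_
  rw [← mul_assoc, ← sub_mul] at hn'
  simpa using add_mem (hle (hb _ hn')) hn

/-- An element whose left annihilator is zero is regular modulo the radical: right multiplication by
it is injective modulo `N ^ k = 0`, so by descent modulo `N`. -/
theorem isRegularMod_of_eq_zero (hz : IsRadicalGenerator z) {b : R}
    (hb : ∀ x, x * b = 0 → x = 0) : IsRegularMod z b := by
  obtain ⟨k, hk⟩ := hz.nilpotent
  have key (j : ℕ) (hj : j ≤ k) : ∀ x, x * b ∈ Ideal.span {z ^ j} → x ∈ Ideal.span {z ^ j} := by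
    induction hj using Nat.decreasingInduction with
    | self => simpa [hk] using hb
    | of_succ j _ ih => exact fun x hx ↦ hz.mem_span_pow_of_succ ih hx
  obtain rfl | hk0 := Nat.eq_zero_or_pos k
  · have : Subsingleton R := subsingleton_of_zero_eq_one (by simpa using hk.symm)
    have (x : R) : x ∈ Ideal.span {z} := Subsingleton.elim 0 x ▸ zero_mem _
    exact fun x ↦ ⟨fun _ ↦ this x, fun _ ↦ this x⟩
  · exact hz.isRegularMod_of_mul_mem (by simpa using key 1 hk0)

end IsRadicalGenerator

section PrincipalIdealRing

variable {R : Type*} [Ring R] [IsPrincipalIdealRing R] [IsPrincipalIdealRing Rᵐᵒᵖ]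

/-- In a principal ideal ring, an element regular on one side is regular. -/
theorem mem_nonZeroDivisors_of_mul_right {b : R} (hb : ∀ x, x * b = 0 → x = 0) : b ∈ R⁰ :=
  (exists_isRadicalGenerator R).elim fun _ hz ↦
    hz.mem_nonZeroDivisors (hz.isRegularMod_of_eq_zero hb)

theorem mem_nonZeroDivisors_of_mul_left {b : R} (hb : ∀ x, b * x = 0 → x = 0) : b ∈ R⁰ :=
  op_mem_nonZeroDivisors_iff.1 <| mem_nonZeroDivisors_of_mul_right fun _ hx ↦
    MulOpposite.unop_injective (hb _ (congrArg MulOpposite.unop hx))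

/-! ### The Ore conditions and the ring of fractions -/

/-- The left Ore condition. The elements `s` with `s a ∈ R c + N` form a left ideal that is
essential modulo `N`, so one of them is regular, and `R c + N = R c` because `N = N c`. -/
theorem exists_mul_eq_mul (a : R) {c : R} (hc : c ∈ R⁰) : ∃ d ∈ R⁰, ∃ e, d * a = e * c := by
  obtain ⟨z, hz⟩ := exists_isRadicalGenerator R
  have := hz.isTwoSided_span
  have hcz : IsRegularMod z c := hz.isRegularMod_of_eq_zero (mem_nonZeroDivisors_iff.1 hc).2
  have hN : Ideal.span {z} ≤ Ideal.span {c} := (Ideal.span_singleton_le_iff_mem _).2 <|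
    (hz.exists_mul_mul_eq hcz).elim fun y hy ↦ Ideal.mem_span_singleton'.2 ⟨y * z, hy⟩
  obtain ⟨d, hd, hdz⟩ := hz.exists_mem_isRegularMod
    (I := Submodule.comap (LinearMap.toSpanSingleton R R a) (Ideal.span {c})) fun y hy ↦ by
      by_cases hya : y * a ∈ Ideal.span {z}
      · exact ⟨1, by rwa [one_mul], by simpa using hN hya⟩
      · obtain ⟨r, hr, n, -, hn⟩ := Ideal.exists_mul_sub_mem_of_injective (A := ⊤) (b := c)
          (fun _ _ ↦ Submodule.mem_top) (fun _ hx ↦ Ideal.mul_mem_right c _ hx)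
          (fun x _ ↦ (hcz x).1) Submodule.mem_top hya
        refine ⟨r, fun h ↦ hr (by rw [← mul_assoc]; exact Ideal.mul_mem_right a _ h), ?_⟩
        have := add_mem (hN hn) (Ideal.mul_mem_left _ n (Ideal.mem_span_singleton_self c))
        rw [sub_add_cancel, ← mul_assoc] at this
        simpa using this
  exact ⟨d, hz.mem_nonZeroDivisors hdz,
    (Ideal.mem_span_singleton'.1 (by simpa using hd)).imp fun _ h ↦ h.symm⟩

theorem exists_mul_eq_mul' (a : R) {c : R} (hc : c ∈ R⁰) : ∃ d ∈ R⁰, ∃ e, a * d = c * e := by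
  obtain ⟨d, hd, e, h⟩ := exists_mul_eq_mul (MulOpposite.op a) (op_mem_nonZeroDivisors_iff.2 hc)
  exact ⟨d.unop, op_mem_nonZeroDivisors_iff.1 hd, e.unop, congrArg MulOpposite.unop h⟩

end PrincipalIdealRing

/-- The ring of fractions is the left Ore localization, with elements `s⁻¹ r`; the right Ore
condition turns these into right fractions. -/
theorem exists_isRingOfFractions (R : Type u) [Ring R] [IsPrincipalIdealRing R]
    [IsPrincipalIdealRing Rᵐᵒᵖ] :
    ∃ (Q : Type u) (_ : Ring Q) (ι : R →+* Q), IsRingOfFractions ι := by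
  choose d hd e hde using fun (a : R) (c : R⁰) ↦ exists_mul_eq_mul a c.2
  let _ : OreLocalization.OreSet R⁰ :=
    { ore_right_cancel := fun r₁ r₂ s h ↦ ⟨1, by
        have := (mem_nonZeroDivisors_iff.1 s.2).2 (r₁ - r₂) (by rw [sub_mul, h, sub_self])
        rw [sub_eq_zero.1 this]⟩
      oreNum := e
      oreDenom := fun a c ↦ ⟨d a c, hd a c⟩
      ore_eq := hde }
  let ι : R →+* OreLocalization R⁰ R := OreLocalization.numeratorRingHom
  have hunit (s : R⁰) : IsUnit (ι s) := OreLocalization.numerator_isUnit s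
  refine ⟨OreLocalization R⁰ R, inferInstance, ι,
    OreLocalization.numeratorHom_inj fun s hs ↦ hs.1, fun b hb ↦ hunit ⟨b, hb⟩, fun f ↦ ?_⟩
  induction f using OreLocalization.ind with | _ r s
  obtain ⟨b, hb, a, h⟩ := exists_mul_eq_mul' r s.2
  obtain ⟨u, hu⟩ := hunit ⟨b, hb⟩
  refine ⟨a, b, hb, u, hu, ?_⟩
  rw [Units.eq_mul_inv_iff_mul_eq, hu]
  -- `(s⁻¹ r) b = a`, as `r b = s a`
  refine (hunit s).mul_left_cancel ?_
  have hs : ι s * OreLocalization.oreDiv r s = ι r := OreLocalization.mul_cancel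
  rw [← mul_assoc, hs, ← map_mul, ← map_mul, h]

/-! ### Coprime decompositions -/

theorem isRightCoprime_iff {R : Type*} [Ring R] {a b : R} :
    IsRightCoprime a b ↔ ∃ u v, u * a + v * b = 1 := by
  rw [IsRightCoprime, ← Submodule.span_union, Set.singleton_union]
  exact (Ideal.eq_top_iff_one _).trans Ideal.mem_span_pair

theorem isLeftCoprime_iff {R : Type*} [Ring R] {a b : R} :
    IsLeftCoprime a b ↔ ∃ u v, a * u + b * v = 1 := by
  rw [IsLeftCoprime, ← Submodule.span_union, Set.singleton_union]
  have h1 : (Submodule.span Rᵐᵒᵖ {a, b} = ⊤) ↔ (1 : R) ∈ Submodule.span Rᵐᵒᵖ {a, b} :=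
    ⟨fun h ↦ h ▸ Submodule.mem_top, fun h ↦ eq_top_iff.2 fun x _ ↦ by
      simpa using Submodule.smul_mem _ (MulOpposite.op x) h⟩
  rw [h1, Submodule.mem_span_pair]
  exact MulOpposite.op_surjective.exists.trans
    (exists_congr fun _ ↦ MulOpposite.op_surjective.exists)

theorem IsRightFraction.eq_mul {R Q : Type*} [Ring R] [Ring Q] {ι : R →+* Q} {f : Q} {a b : R}
    (h : IsRightFraction ι f a b) : ι a = f * ι b := by
  obtain ⟨-, u, hu, rfl⟩ := h
  rw [← hu, Units.inv_mul_cancel_right]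

/-- The reduced right fraction of `f = a₀ b₀⁻¹` arises by cancelling a generator `d` of the left
ideal `R a₀ + R b₀`. If `u a + v b = 1`, then `q = u a' + v b'` is `b⁻¹ b'` in the ring of
fractions. -/
theorem IsRingOfFractions.exists_isRightCoprime {R Q : Type*} [Ring R] [Ring Q]
    [IsPrincipalIdealRing R] [IsPrincipalIdealRing Rᵐᵒᵖ] {ι : R →+* Q}
    (hι : IsRingOfFractions ι) (f : Q) :
    ∃ a b : R, IsRightFraction ι f a b ∧ IsRightCoprime a b ∧
      ∀ a' b' : R, IsRightFraction ι f a' b' → ∃ q ∈ R⁰, a' = a * q ∧ b' = b * q := by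
  obtain ⟨a₀, b₀, hf⟩ := hι.exists_fraction f
  obtain ⟨d, hd⟩ := IsPrincipalIdealRing.principal (Ideal.span {a₀, b₀})
  have mem_d (x : R) : x ∈ Ideal.span {a₀, b₀} ↔ ∃ r, r * d = x := by
    rw [hd]
    exact Ideal.mem_span_singleton'
  obtain ⟨a, rfl⟩ := (mem_d a₀).1 (Ideal.subset_span (by simp))
  obtain ⟨b, rfl⟩ := (mem_d b₀).1 (Ideal.subset_span (by simp))
  obtain ⟨u, v, huv⟩ := Ideal.mem_span_pair.1 ((mem_d d).2 ⟨1, one_mul d⟩)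
  have hbd := mem_nonZeroDivisors_iff.1 hf.1
  have hdreg : d ∈ R⁰ := mem_nonZeroDivisors_of_mul_left fun x hx ↦
    hbd.1 x (by rw [mul_assoc, hx, mul_zero])
  have hb : b ∈ R⁰ := mem_nonZeroDivisors_of_mul_right fun x hx ↦
    hbd.2 x (by rw [← mul_assoc, hx, zero_mul])
  have hone : u * a + v * b = 1 := by
    refine sub_eq_zero.1 ((mem_nonZeroDivisors_iff.1 hdreg).2 _ ?_)
    rw [sub_mul, add_mul, one_mul, mul_assoc, mul_assoc, huv, sub_self]
  have hfb : ι a = f * ι b := by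
    refine (hι.isUnit_of_regular d hdreg).mul_right_cancel ?_
    rw [← map_mul, hf.eq_mul, map_mul, mul_assoc]
  obtain ⟨w, hw⟩ := hι.isUnit_of_regular b hb
  refine ⟨a, b, ⟨hb, w, hw, by rw [Units.eq_mul_inv_iff_mul_eq, hw, hfb]⟩,
    isRightCoprime_iff.2 ⟨u, v, hone⟩, fun a' b' h' ↦ ?_⟩
  have hq : ι b' = ι b * ι (u * a' + v * b') := by
    have h1 : (ι u * f + ι v) * ι b = 1 := by
      rw [add_mul, mul_assoc, ← hfb, ← map_mul, ← map_mul, ← map_add, hone, map_one]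
    have h2 : ι b * (ι u * f + ι v) = 1 := by
      rw [← hw] at h1 ⊢
      rw [← Units.inv_eq_of_mul_eq_one_left h1, Units.mul_inv]
    rw [map_add, map_mul, map_mul, h'.eq_mul, ← mul_assoc (ι u), ← add_mul, ← mul_assoc, h2,
      one_mul]
  have hb' : b' = b * (u * a' + v * b') := hι.injective (by rw [map_mul, hq.symm])
  refine ⟨u * a' + v * b', mem_nonZeroDivisors_of_mul_left fun x hx ↦
    (mem_nonZeroDivisors_iff.1 h'.1).1 x (by rw [hb', mul_assoc, hx, mul_zero]), ?_, hb'⟩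
  exact hι.injective (by rw [h'.eq_mul, hq, map_mul, hfb, mul_assoc])

theorem isRightFraction_op_iff {R Q : Type*} [Ring R] [Ring Q] {ι : R →+* Q} {f : Q} {a b : R} :
    IsRightFraction (RingHom.op ι) (.op f) (.op a) (.op b) ↔ IsLeftFraction ι f a b := by
  refine and_congr op_mem_nonZeroDivisors_iff
    ⟨fun ⟨u, hu, h⟩ ↦ ⟨(Units.opEquiv u).unop, congrArg MulOpposite.unop hu,
      congrArg MulOpposite.unop h⟩,
    fun ⟨u, hu, h⟩ ↦ ⟨Units.opEquiv.symm (.op u), congrArg MulOpposite.op hu,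
      congrArg MulOpposite.op h⟩⟩

/-- The opposite of a ring of fractions is one for the opposite ring: a right fraction `a b⁻¹` is
rewritten as a left fraction by the left Ore condition. -/
theorem IsRingOfFractions.op {R Q : Type*} [Ring R] [Ring Q]
    [IsPrincipalIdealRing R] [IsPrincipalIdealRing Rᵐᵒᵖ] {ι : R →+* Q}
    (hι : IsRingOfFractions ι) : IsRingOfFractions (RingHom.op ι) where
  injective _ _ h := MulOpposite.unop_injective (hι.injective (congrArg MulOpposite.unop h))
  isUnit_of_regular b hb :=
    (hι.isUnit_of_regular b.unop (op_mem_nonZeroDivisors_iff.1 hb)).op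
  exists_fraction f := by
    obtain ⟨a, b, hf⟩ := hι.exists_fraction f.unop
    obtain ⟨d, hd, e, hde⟩ := exists_mul_eq_mul a hf.1
    obtain ⟨u, hu⟩ := hι.isUnit_of_regular d hd
    refine ⟨.op e, .op d, isRightFraction_op_iff (f := f.unop).2 ⟨hd, u, hu, ?_⟩⟩
    rw [Units.eq_inv_mul_iff_mul_eq, hu]
    refine (hι.isUnit_of_regular b hf.1).mul_right_cancel ?_
    rw [mul_assoc, ← hf.eq_mul, ← map_mul, hde, map_mul]

theorem IsRingOfFractions.exists_isLeftCoprime {R Q : Type*} [Ring R] [Ring Q]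
    [IsPrincipalIdealRing R] [IsPrincipalIdealRing Rᵐᵒᵖ] {ι : R →+* Q}
    (hι : IsRingOfFractions ι) (f : Q) :
    ∃ a b : R, IsLeftFraction ι f a b ∧ IsLeftCoprime a b ∧
      ∀ a' b' : R, IsLeftFraction ι f a' b' → ∃ q ∈ R⁰, a' = q * a ∧ b' = q * b := by
  obtain ⟨a, b, hf, hab, hmin⟩ := hι.op.exists_isRightCoprime (.op f)
  obtain ⟨u, v, huv⟩ := isRightCoprime_iff.1 hab
  refine ⟨a.unop, b.unop, isRightFraction_op_iff.1 hf,
    isLeftCoprime_iff.2 ⟨u.unop, v.unop, congrArg MulOpposite.unop huv⟩, fun a' b' h' ↦ ?_⟩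
  obtain ⟨q, hq, ha, hb⟩ := hmin _ _ (isRightFraction_op_iff.2 h')
  exact ⟨q.unop, op_mem_nonZeroDivisors_iff.1 hq, congrArg MulOpposite.unop ha,
    congrArg MulOpposite.unop hb⟩

theorem corollary20121122 {R : Type u} [Ring R]
    -- every left ideal of `R` is principal, and so is every right ideal
    [IsPrincipalIdealRing R] [IsPrincipalIdealRing Rᵐᵒᵖ] :
    -- the ring of fractions exists
    (∃ (Q : Type u) (_ : Ring Q) (ι : R →+* Q), IsRingOfFractions ι) ∧
    -- each element of it has minimal right and left fractional decompositions
    ∀ (Q : Type v) [Ring Q] (ι : R →+* Q), IsRingOfFractions ι → ∀ f : Q,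
      (∃ a b : R, IsRightFraction ι f a b ∧ IsRightCoprime a b ∧
        ∀ a' b' : R, IsRightFraction ι f a' b' → ∃ q ∈ R⁰, a' = a * q ∧ b' = b * q) ∧
      (∃ a b : R, IsLeftFraction ι f a b ∧ IsLeftCoprime a b ∧
        ∀ a' b' : R, IsLeftFraction ι f a' b' → ∃ q ∈ R⁰, a' = q * a ∧ b' = q * b) :=
  ⟨exists_isRingOfFractions R, fun _ _ _ hι f ↦
    ⟨hι.exists_isRightCoprime f, hι.exists_isLeftCoprime f⟩⟩
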